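/- **Types.** Type expressions are given by $\tau ::= t \mid \tau+\tau \mid \tau\times\tau \mid \tau\to\tau \mid \mu t.\tau \mid \mathsf{void}$, with $t$ ranging over a denumerable set of type variables; *types* are the closed type expressions. Unfolding is the relation that replaces one outermost subexpression $\mu t.\tau$ (i.e. one not inside another $\mu$) by $\tau[\mu t.\tau/t]$. The type tree $\tau^*$ of a type $\tau$ is the set of all simple types (built from $\mathsf{void},+,\times,\to$ only) that are obtained from some iterated unfolding of $\tau$ by replacing subexpressions by $\mathsf{void}$. Types are equivalent, $\sigma\approx\tau$, if $\sigma^*=\tau^*$. **Terms.** Terms are built, modulo $\alpha$-conversion, by application $MN$ and abstraction $\lambda x^\sigma.M$ from variables $x^\sigma$ (denumerably many for each type $\sigma$) and, for all types $\sigma,\tau,\rho$, the constants $0_{\sigma,\tau}:\sigma\to(\sigma+\tau)$, $1_{\sigma,\tau}:\tau\to(\sigma+\tau)$, $\mathsf{case}_{\sigma,\tau,\rho}:(\sigma+\tau)\to(\sigma\to\rho)\to(\tau\to\rho)\to\rho$, $\mathsf{pcase}_{\sigma,\tau,\rho}:(\sigma+\tau)\to\rho\to\rho\to\rho$, $\mathsf{pair}_{\sigma,\tau}:\sigma\to\tau\to(\sigma\times\tau)$,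 $\mathsf{fst}_{\sigma,\tau}:(\sigma\times\tau)\to\sigma$, $\mathsf{snd}_{\sigma,\tau}:(\sigma\times\tau)\to\tau$, $\Omega_\sigma:\sigma$. The type subscripts of constants are taken up to $\approx$. The typing relation $M:\sigma$ is generated by: a constant has its type; $x^\sigma:\sigma$; if $M:\tau$ then $\lambda x^\sigma.M:\sigma\to\tau$; if $M:\sigma\to\tau$ and $N:\sigma$ then $MN:\tau$; if $M:\sigma$ and $\sigma\approx\tau$ then $M:\tau$. A term is typed if it has some type. **Reduction.** One-step reduction $\to$ is the least relation on terms, closed under application (on either side) and abstraction, that contains $\beta$-reduction $(\lambda x^\sigma.M)N\to M[x:=N]$ and, for arbitrary terms in place of the variables (subscripts not shown being arbitrary), $$\begin{array}{rcl} \mathsf{case}\,(0\,x)\,y\,z&\to& y\,x\\ \mathsf{case}\,(1\,x)\,y\,z&\to& z\,x\\ \mathsf{fst}\,(\mathsf{pair}\,x\,y)&\to& x\\ \mathsf{snd}\,(\mathsf{pair}\,x\,y)&\to& y\\ \mathsf{pcase}\,(0\,x)\,y\,z&\to& y\\ \mathsf{pcase}\,(1\,x)\,y\,z&\to& z\\ \mathsf{pcase}_{\sigma,\tau,\rho_0+\rho_1}\,x\,(0\,y)\,(0\,z)&\to&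 0_{\rho_0,\rho_1}\,(\mathsf{pcase}_{\sigma,\tau,\rho_0}\,x\,y\,z)\\ \mathsf{pcase}_{\sigma,\tau,\rho_0+\rho_1}\,x\,(1\,y)\,(1\,z)&\to& 1_{\rho_0,\rho_1}\,(\mathsf{pcase}_{\sigma,\tau,\rho_1}\,x\,y\,z)\\ \mathsf{pcase}_{\sigma,\tau,\rho_1\times\rho_2}\,x\,(\mathsf{pair}\,y_1\,y_2)\,(\mathsf{pair}\,z_1\,z_2)&\to& \mathsf{pair}_{\rho_1,\rho_2}\,(\mathsf{pcase}_{\sigma,\tau,\rho_1}\,x\,y_1\,z_1)\,(\mathsf{pcase}_{\sigma,\tau,\rho_2}\,x\,y_2\,z_2)\\ \mathsf{pcase}_{\sigma,\tau,\rho_1\to\rho_2}\,x\,y\,z\,w&\to& \mathsf{pcase}_{\sigma,\tau,\rho_2}\,x\,(y\,w)\,(z\,w). \end{array}$$ Let $\to^*$ be the reflexive, transitive closure of $\to$. **Theorem (Confluence).** Reduction is confluent (Church–Rosser) on typed terms: for every typed term $M$ and all terms $N,P$ with $M\to^* N$ and $M\to^* P$ there is a term $Q$ with $N\to^* Q$ and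 $P\to^* Q$. Moreover $N$, $P$, $Q$ are typed with types equivalent to that of $M$: if $M:\sigma$, then the types of each of $N,P,Q$ are exactly the types $\tau$ with $\sigma\approx\tau$. -/

import Mathlib

namespace RecTypedCalculus

/-! ## Recursive types -/

/-- The binary type constructors: separated sum, separated product, function space. -/
inductive TyOp
  | sum
  | prod
  | arr

/-- Type expressions `t | τ + τ | τ × τ | τ → τ | μ t. τ | void`; type variables are numbers. -/
inductive TypeExp
  | var (t : ℕ)
  | bin (op : TyOp) (a b : TypeExp)
  | mu (t : ℕ) (a : TypeExp)
  | void

namespace TypeExp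

/-- The free type variables of a type expression. -/
def freeVars : TypeExp → Finset ℕ
  | var t => {t}
  | bin _ a b => a.freeVars ∪ b.freeVars
  | mu t a => a.freeVars.erase t
  | void => ∅

/-- `a.replace t r` is `a[r / t]`: all free occurrences of `t` in `a` are replaced by `r`.
It is only used for closed `r`, so that no variable can be captured. -/
def replace : TypeExp → ℕ → TypeExp → TypeExp
  | var s, t, r => if s = t then r else var s
  | bin op a b, t, r => bin op (a.replace t r) (b.replace t r)
  | mu s a, t, r => if s = t then mu s a else mu s (a.replace t r)
  | void, _, _ => void

/-- One step of unfolding an outermost `μ`. Closed expressions unfold to closed expressions. -/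
inductive Unfold : TypeExp → TypeExp → Prop
  | mu (t : ℕ) (a : TypeExp) : Unfold (mu t a) (a.replace t (mu t a))
  | left (op : TyOp) {a a' : TypeExp} (b : TypeExp) :
      Unfold a a' → Unfold (bin op a b) (bin op a' b)
  | right (op : TyOp) (a : TypeExp) {b b' : TypeExp} :
      Unfold b b' → Unfold (bin op a b) (bin op a b')

end TypeExp

/-- Simple types: built from `void` by the binary type constructors. -/
inductive SimpleType
  | void
  | bin (op : TyOp) (a b : SimpleType)

/-- The void-prefix order between simple types and type expressions. -/
inductive VoidPrefix : SimpleType → TypeExp → Prop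
  | void (a : TypeExp) : VoidPrefix .void a
  | bin (op : TyOp) {s t : SimpleType} {a b : TypeExp} :
      VoidPrefix s a → VoidPrefix t b → VoidPrefix (.bin op s t) (.bin op a b)

/-- The type tree `a*` of a type expression: all void-prefixes of its iterated unfoldings. -/
def TypeExp.tree (a : TypeExp) : Set SimpleType :=
  {s | ∃ a', Relation.ReflTransGen TypeExp.Unfold a a' ∧ VoidPrefix s a'}

/-- Types: the closed type expressions. -/
structure ClosedType where
  exp : TypeExp
  closed : exp.freeVars = ∅

/-- The type constructors on (closed) types. -/
def ClosedType.bin (op : TyOp) (σ τ : ClosedType) : ClosedType :=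
  ⟨.bin op σ.exp τ.exp, by simp [TypeExp.freeVars, σ.closed, τ.closed]⟩

/-- Equivalence of types, `σ ≈ τ`: they unfold to the same type tree. -/
instance ClosedType.setoid : Setoid ClosedType where
  r σ τ := σ.exp.tree = τ.exp.tree
  iseqv := ⟨fun _ => rfl, fun h => h.symm, fun h h' => h.trans h'⟩

/-- Types up to equivalence (type trees of types). -/
def TypeTree : Type := Quotient ClosedType.setoid

/-- The type tree of a type. -/
def ClosedType.toTree (σ : ClosedType) : TypeTree := Quotient.mk ClosedType.setoid σ

theorem TypeExp.unfolds_bin_iff (op : TyOp) (a b c : TypeExp) :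
    Relation.ReflTransGen TypeExp.Unfold (.bin op a b) c ↔
      ∃ a' b', c = .bin op a' b' ∧ Relation.ReflTransGen TypeExp.Unfold a a' ∧
        Relation.ReflTransGen TypeExp.Unfold b b' := by
  constructor
  · intro h
    induction h with
    | refl => exact ⟨a, b, rfl, .refl, .refl⟩
    | tail _ hs ih =>
      obtain ⟨a', b', rfl, ha, hb⟩ := ih
      cases hs with
      | left _ _ h => exact ⟨_, _, rfl, ha.tail h, hb⟩
      | right _ _ h => exact ⟨_, _, rfl, ha, hb.tail h⟩
  · rintro ⟨a', b', rfl, ha, hb⟩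
    exact (Relation.ReflTransGen.lift (r := TypeExp.Unfold) (fun x => TypeExp.bin op x b)
        (fun _ _ h => TypeExp.Unfold.left op b h) _ _ ha).trans
      (Relation.ReflTransGen.lift (r := TypeExp.Unfold) (fun x => TypeExp.bin op a' x)
        (fun _ _ h => TypeExp.Unfold.right op a' h) _ _ hb)

theorem TypeExp.tree_bin (op : TyOp) (a b : TypeExp) :
    (TypeExp.bin op a b).tree =
      {u | u = .void ∨ ∃ s ∈ a.tree, ∃ t ∈ b.tree, u = .bin op s t} := by
  ext u
  constructor
  · rintro ⟨c, hc, hu⟩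
    obtain ⟨a', b', rfl, ha, hb⟩ := (TypeExp.unfolds_bin_iff op a b c).1 hc
    cases hu with
    | void => exact Or.inl rfl
    | bin _ hs ht => exact Or.inr ⟨_, ⟨a', ha, hs⟩, _, ⟨b', hb, ht⟩, rfl⟩
  · rintro (rfl | ⟨s, ⟨a', ha, hs⟩, t, ⟨b', hb, ht⟩, rfl⟩)
    · exact ⟨_, .refl, .void _⟩
    · exact ⟨_, (TypeExp.unfolds_bin_iff op a b _).2 ⟨a', b', rfl, ha, hb⟩, .bin op hs ht⟩

/-- The type constructors on types up to equivalence. -/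
def TypeTree.bin (op : TyOp) : TypeTree → TypeTree → TypeTree :=
  Quotient.map₂ (ClosedType.bin op) (by
    intro σ σ' (h : σ.exp.tree = σ'.exp.tree) τ τ' (h' : τ.exp.tree = τ'.exp.tree)
    change (TypeExp.bin op σ.exp τ.exp).tree = (TypeExp.bin op σ'.exp τ'.exp).tree
    rw [TypeExp.tree_bin, TypeExp.tree_bin, h, h'])

/-- Separated sum. -/
abbrev TypeTree.sum (σ τ : TypeTree) : TypeTree := .bin .sum σ τ

/-- Separated product. -/
abbrev TypeTree.prod (σ τ : TypeTree) : TypeTree := .bin .prod σ τ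

/-- Function space. -/
abbrev TypeTree.arr (σ τ : TypeTree) : TypeTree := .bin .arr σ τ

/-! ## Terms -/

/-- The constants `0`, `1`, `case`, `pcase`, `pair`, `fst`, `snd`, `Ω`. Their type subscripts
are types up to equivalence: equivalent subscripts give the same constant. -/
inductive Const
  | zero (σ τ : TypeTree)
  | one (σ τ : TypeTree)
  | scase (σ τ ρ : TypeTree)
  | pcase (σ τ ρ : TypeTree)
  | pair (σ τ : TypeTree)
  | fst (σ τ : TypeTree)
  | snd (σ τ : TypeTree)
  | omega (σ : TypeTree)

/-- The type of a constant, up to equivalence. -/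
def Const.ctype : Const → TypeTree
  | zero σ τ => .arr σ (.sum σ τ)
  | one σ τ => .arr τ (.sum σ τ)
  | scase σ τ ρ => .arr (.sum σ τ) (.arr (.arr σ ρ) (.arr (.arr τ ρ) ρ))
  | pcase σ τ ρ => .arr (.sum σ τ) (.arr ρ (.arr ρ ρ))
  | pair σ τ => .arr σ (.arr τ (.prod σ τ))
  | fst σ τ => .arr (.prod σ τ) σ
  | snd σ τ => .arr (.prod σ τ) τ
  | omega σ => σ

/-- Untyped terms up to α-conversion. `fvar σ n` is the `n`-th variable of type `σ`; an occurrence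
of a variable bound by a `λ` is a de Bruijn index `bvar i`; `lam σ M` is `λ x^σ. M`. -/
inductive Term
  | fvar (σ : ClosedType) (n : ℕ)
  | bvar (i : ℕ)
  | const (c : Const)
  | app (M N : Term)
  | lam (σ : ClosedType) (M : Term)

namespace Term

/-- A renaming of indices, extended under a binder. -/
def upRen (f : ℕ → ℕ) : ℕ → ℕ
  | 0 => 0
  | i + 1 => f i + 1

/-- Renaming of the indices of a term. -/
def rename : (ℕ → ℕ) → Term → Term
  | _, fvar σ n => fvar σ n
  | f, bvar i => bvar (f i)
  | _, const c => const c
  | f, app M N => app (M.rename f) (N.rename f)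
  | f, lam σ M => lam σ (M.rename (upRen f))

/-- A substitution for indices, extended under a binder. -/
def upSub (s : ℕ → Term) : ℕ → Term
  | 0 => bvar 0
  | i + 1 => (s i).rename Nat.succ

/-- Simultaneous capture-avoiding substitution for the indices of a term. -/
def subst : (ℕ → Term) → Term → Term
  | _, fvar σ n => fvar σ n
  | s, bvar i => s i
  | _, const c => const c
  | s, app M N => app (M.subst s) (N.subst s)
  | s, lam σ M => lam σ (M.subst (upSub s))

/-- Index `0` is replaced by `N`, the other indices are lowered by one. -/
def single (N : Term) : ℕ → Term
  | 0 => N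
  | i + 1 => bvar i

/-- For an abstraction `lam σ M`, `M.inst N` is the body `M` with the bound variable replaced
by `N`. -/
def inst (M N : Term) : Term := M.subst (single N)

/-- Application of a constant to one argument. -/
abbrev app1 (c : Const) (M : Term) : Term := app (const c) M

/-- Application of a constant to two arguments. -/
abbrev app2 (c : Const) (M N : Term) : Term := app (app1 c M) N

/-- Application of a constant to three arguments. -/
abbrev app3 (c : Const) (M N P : Term) : Term := app (app2 c M N) P

end Term

open Term in
/-- `HasType Γ M σ`: `M` has type `σ`, where `Γ` lists the types of the variables bound by the
abstractions around `M`, innermost first. -/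
inductive HasType : List ClosedType → Term → ClosedType → Prop
  | const {Γ : List ClosedType} {c : Const} {σ : ClosedType} :
      σ.toTree = c.ctype → HasType Γ (const c) σ
  | fvar {Γ : List ClosedType} (σ : ClosedType) (n : ℕ) : HasType Γ (fvar σ n) σ
  | bvar {Γ : List ClosedType} {i : ℕ} {σ : ClosedType} :
      Γ[i]? = some σ → HasType Γ (bvar i) σ
  | lam {Γ : List ClosedType} {σ τ : ClosedType} {M : Term} :
      HasType (σ :: Γ) M τ → HasType Γ (lam σ M) (.bin .arr σ τ)
  | app {Γ : List ClosedType} {σ τ : ClosedType} {M N : Term} :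
      HasType Γ M (.bin .arr σ τ) → HasType Γ N σ → HasType Γ (app M N) τ
  | equiv {Γ : List ClosedType} {σ τ : ClosedType} {M : Term} :
      HasType Γ M σ → σ ≈ τ → HasType Γ M τ

/-- `M : σ`, for terms in which every index is bound. -/
def Term.OfType (M : Term) (σ : ClosedType) : Prop := HasType [] M σ

/-! ## Reduction -/

open Term in
/-- One-step reduction: `β` and the rewrite rules for the constants, in any context.
Subscripts written as primed letters are arbitrary. -/
inductive Red : Term → Term → Prop
  | beta (σ : ClosedType) (M N : Term) : Red (app (lam σ M) N) (M.inst N)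
  | appLeft {M M' : Term} (N : Term) : Red M M' → Red (app M N) (app M' N)
  | appRight (M : Term) {N N' : Term} : Red N N' → Red (app M N) (app M N')
  | lam (σ : ClosedType) {M M' : Term} : Red M M' → Red (lam σ M) (lam σ M')
  | case_zero (σ τ ρ σ' τ' : TypeTree) (x y z : Term) :
      Red (app3 (.scase σ τ ρ) (app1 (.zero σ' τ') x) y z) (app y x)
  | case_one (σ τ ρ σ' τ' : TypeTree) (x y z : Term) :
      Red (app3 (.scase σ τ ρ) (app1 (.one σ' τ') x) y z) (app z x)
  | fst_pair (σ τ σ' τ' : TypeTree) (x y : Term) :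
      Red (app1 (.fst σ τ) (app2 (.pair σ' τ') x y)) x
  | snd_pair (σ τ σ' τ' : TypeTree) (x y : Term) :
      Red (app1 (.snd σ τ) (app2 (.pair σ' τ') x y)) y
  | pcase_zero (σ τ ρ σ' τ' : TypeTree) (x y z : Term) :
      Red (app3 (.pcase σ τ ρ) (app1 (.zero σ' τ') x) y z) y
  | pcase_one (σ τ ρ σ' τ' : TypeTree) (x y z : Term) :
      Red (app3 (.pcase σ τ ρ) (app1 (.one σ' τ') x) y z) z
  | pcase_zero_zero (σ τ ρ₀ ρ₁ σ' τ' σ'' τ'' : TypeTree) (x y z : Term) :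
      Red (app3 (.pcase σ τ (.sum ρ₀ ρ₁)) x (app1 (.zero σ' τ') y) (app1 (.zero σ'' τ'') z))
        (app1 (.zero ρ₀ ρ₁) (app3 (.pcase σ τ ρ₀) x y z))
  | pcase_one_one (σ τ ρ₀ ρ₁ σ' τ' σ'' τ'' : TypeTree) (x y z : Term) :
      Red (app3 (.pcase σ τ (.sum ρ₀ ρ₁)) x (app1 (.one σ' τ') y) (app1 (.one σ'' τ'') z))
        (app1 (.one ρ₀ ρ₁) (app3 (.pcase σ τ ρ₁) x y z))
  | pcase_pair_pair (σ τ ρ₁ ρ₂ σ' τ' σ'' τ'' : TypeTree) (x y₁ y₂ z₁ z₂ : Term) :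
      Red (app3 (.pcase σ τ (.prod ρ₁ ρ₂)) x (app2 (.pair σ' τ') y₁ y₂)
          (app2 (.pair σ'' τ'') z₁ z₂))
        (app2 (.pair ρ₁ ρ₂) (app3 (.pcase σ τ ρ₁) x y₁ z₁) (app3 (.pcase σ τ ρ₂) x y₂ z₂))
  | pcase_arr (σ τ ρ₁ ρ₂ : TypeTree) (x y z w : Term) :
      Red (app (app3 (.pcase σ τ (.arr ρ₁ ρ₂)) x y z) w)
        (app3 (.pcase σ τ ρ₂) x (app y w) (app z w))

/-- The reflexive, transitive closure of one-step reduction. -/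
def Reds : Term → Term → Prop := Relation.ReflTransGen Red

end RecTypedCalculus

namespace RecTypedCalculus

/-! ## Type trees -/

/-! This is the method of Tait and Martin-Löf, with complete developments, for a rewrite system with
overlapping rules. Parallel reduction lies between `Red` and `Reds` (`Par.of_red`, `Par.reds`), so
the diamond property of `Par` on typed terms suffices. It follows once every typed term `M` has a
term `M'` to which each parallel reduct of `M` goes in one further parallel step
(`HasTree.exists_isDev`).

The overlaps come from `pcase` when its first argument is an injection and a structural rule applies
as well; the development then contracts `pcase_zero` or `pcase_one`. For `pcase (0 x) (0 y) (0 z)`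
one side is `0 y` with the subscripts of that `0`, the other is `0 (pcase (0 x) y z)` with
subscripts taken from `pcase`. They can be joined because typing makes these subscripts equal; this
is where the typing hypothesis is essential. For `pcase (0 x) y z w` both sides lead to `y w`. Two
structural rules never compete on one `pcase` applied to arguments of different shape, since sum,
product and arrow trees are distinct.

Equality of subscripts rests on the injectivity of the type constructors on type trees
(`TypeTree.bin_inj`). Typing is therefore recast as `HasTree`, where equivalence of types is
equality; subject reduction (`HasTree.red`) and uniqueness (`HasTree.unique`) then also describe the
types of all reducts. -/

theorem TypeExp.void_mem_tree (a : TypeExp) : SimpleType.void ∈ a.tree :=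
  ⟨a, .refl, .void a⟩

theorem TypeExp.bin_mem_tree_bin {op op' : TyOp} {a b : TypeExp} {s t : SimpleType} :
    SimpleType.bin op' s t ∈ (TypeExp.bin op a b).tree ↔ op' = op ∧ s ∈ a.tree ∧ t ∈ b.tree := by
  rw [TypeExp.tree_bin]
  constructor
  · rintro (h | ⟨s', hs, t', ht, h⟩)
    · cases h
    · cases h
      exact ⟨rfl, hs, ht⟩
  · rintro ⟨rfl, hs, ht⟩
    exact Or.inr ⟨s, hs, t, ht, rfl⟩

/-- The type constructors are injective and have disjoint ranges, also up to equivalence. -/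
theorem TypeTree.bin_inj {op op' : TyOp} {a b a' b' : TypeTree} :
    TypeTree.bin op a b = TypeTree.bin op' a' b' ↔ op = op' ∧ a = a' ∧ b = b' := by
  refine ⟨fun h => ?_, by rintro ⟨rfl, rfl, rfl⟩; rfl⟩
  induction a using Quotient.ind with | _ a
  induction b using Quotient.ind with | _ b
  induction a' using Quotient.ind with | _ a'
  induction b' using Quotient.ind with | _ b'
  have h' : (TypeExp.bin op a.exp b.exp).tree = (TypeExp.bin op' a'.exp b'.exp).tree :=
    Quotient.exact h
  -- The two trees have the same binary members. As `void` lies in every tree, setting both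
  -- components to `void` compares the constructors, and setting one to `void` isolates the other.
  have key : ∀ s t, s ∈ a.exp.tree ∧ t ∈ b.exp.tree ↔
      op = op' ∧ s ∈ a'.exp.tree ∧ t ∈ b'.exp.tree := fun s t => by
    rw [← TypeExp.bin_mem_tree_bin, ← h', TypeExp.bin_mem_tree_bin]
    simp
  have hop := ((key .void .void).1 ⟨a.exp.void_mem_tree, b.exp.void_mem_tree⟩).1
  refine ⟨hop, Quotient.sound (Set.ext fun s => ?_), Quotient.sound (Set.ext fun t => ?_)⟩
  · simpa [TypeExp.void_mem_tree, hop] using key s .void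
  · simpa [TypeExp.void_mem_tree, hop] using key .void t

theorem ClosedType.toTree_eq_iff {σ τ : ClosedType} : σ.toTree = τ.toTree ↔ σ ≈ τ :=
  Quotient.eq

theorem ClosedType.toTree_bin (op : TyOp) (σ τ : ClosedType) :
    (ClosedType.bin op σ τ).toTree = .bin op σ.toTree τ.toTree := rfl

/-! ## Typing up to equivalence -/

/-- `HasTree Γ M t`: the types of `M` are the types with type tree `t`. -/
def HasTree : List ClosedType → Term → TypeTree → Prop
  | _, .const c, t => t = c.ctype
  | _, .fvar σ _, t => t = σ.toTree
  | Γ, .bvar i, t => ∃ σ, Γ[i]? = some σ ∧ t = σ.toTree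
  | Γ, .lam σ M, t => ∃ u, HasTree (σ :: Γ) M u ∧ t = .arr σ.toTree u
  | Γ, .app M N, t => ∃ s, HasTree Γ M (.arr s t) ∧ HasTree Γ N s

/-- The rules are syntax-directed; the application case reads the result type off the arrow by
injectivity. -/
theorem HasTree.unique {Γ : List ClosedType} {M : Term} {t u : TypeTree} (h : HasTree Γ M t)
    (h' : HasTree Γ M u) : t = u := by
  induction M generalizing Γ t u with
  | fvar σ n => exact h.trans h'.symm
  | const c => exact h.trans h'.symm
  | bvar i =>
    obtain ⟨σ, hσ, rfl⟩ := h
    obtain ⟨τ, hτ, rfl⟩ := h'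
    rw [hσ] at hτ
    cases hτ
    rfl
  | app M N ihM _ =>
    obtain ⟨s, h, -⟩ := h
    obtain ⟨s', h', -⟩ := h'
    exact (TypeTree.bin_inj.1 (ihM h h')).2.2
  | lam σ M ih =>
    obtain ⟨s, h, rfl⟩ := h
    obtain ⟨s', h', rfl⟩ := h'
    rw [ih h h']

/-- The conversion rule disappears in the quotient. With the converse below, inversion of typing
needs no account of conversion steps. -/
theorem HasType.hasTree {Γ : List ClosedType} {M : Term} {σ : ClosedType} (h : HasType Γ M σ) :
    HasTree Γ M σ.toTree := by
  induction h with
  | const h => exact h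
  | fvar => rfl
  | bvar h => exact ⟨_, h, rfl⟩
  | lam _ ih => exact ⟨_, ih, rfl⟩
  | app _ _ ihM ihN =>
    rw [ClosedType.toTree_bin] at ihM
    exact ⟨_, ihM, ihN⟩
  | equiv _ h ih => exact ClosedType.toTree_eq_iff.2 h ▸ ih

theorem HasTree.hasType {Γ : List ClosedType} {M : Term} {σ : ClosedType}
    (h : HasTree Γ M σ.toTree) : HasType Γ M σ := by
  induction M generalizing Γ σ with
  | fvar τ n => exact .equiv (.fvar τ n) (ClosedType.toTree_eq_iff.1 (Eq.symm h))
  | const c => exact .const h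
  | bvar i =>
    obtain ⟨τ, hτ, h⟩ := h
    exact .equiv (.bvar hτ) (ClosedType.toTree_eq_iff.1 h.symm)
  | app M N ihM ihN =>
    obtain ⟨s, hM, hN⟩ := h
    induction s using Quotient.ind with | _ s
    exact .app (ihM (σ := .bin .arr s σ) hM) (ihN hN)
  | lam τ M ih =>
    obtain ⟨u, hM, h⟩ := h
    induction u using Quotient.ind with | _ u
    exact .equiv (.lam (ih (σ := u) hM)) (ClosedType.toTree_eq_iff.1 h.symm)

theorem HasTree.ofType_iff {M : Term} {t : TypeTree} (h : HasTree [] M t) (σ : ClosedType) :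
    M.OfType σ ↔ t = σ.toTree :=
  ⟨fun h' => h.unique (HasType.hasTree h'), fun h' => HasTree.hasType (h' ▸ h)⟩

theorem HasTree.rename {Γ Δ : List ClosedType} {M : Term} {t : TypeTree} {f : ℕ → ℕ}
    (h : HasTree Γ M t) (hf : ∀ i σ, Γ[i]? = some σ → Δ[f i]? = some σ) :
    HasTree Δ (M.rename f) t := by
  induction M generalizing Γ Δ t f with
  | fvar | const => exact h
  | bvar i =>
    obtain ⟨σ, hσ, h⟩ := h
    exact ⟨σ, hf i σ hσ, h⟩
  | app M N ihM ihN =>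
    obtain ⟨s, hM, hN⟩ := h
    exact ⟨s, ihM hM hf, ihN hN hf⟩
  | lam τ M ih =>
    obtain ⟨u, hM, h⟩ := h
    refine ⟨u, ih hM ?_, h⟩
    rintro (_ | i) σ hσ
    · exact hσ
    · exact hf i σ hσ

theorem HasTree.subst {Γ Δ : List ClosedType} {M : Term} {t : TypeTree} {s : ℕ → Term}
    (h : HasTree Γ M t) (hs : ∀ i σ, Γ[i]? = some σ → HasTree Δ (s i) σ.toTree) :
    HasTree Δ (M.subst s) t := by
  induction M generalizing Γ Δ t s with
  | fvar | const => exact h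
  | bvar i =>
    obtain ⟨σ, hσ, rfl⟩ := h
    exact hs i σ hσ
  | app M N ihM ihN =>
    obtain ⟨s, hM, hN⟩ := h
    exact ⟨s, ihM hM hs, ihN hN hs⟩
  | lam τ M ih =>
    obtain ⟨u, hM, h⟩ := h
    refine ⟨u, ih hM ?_, h⟩
    rintro (_ | i) σ hσ
    · exact ⟨σ, hσ, rfl⟩
    · exact (hs i σ hσ).rename fun _ _ h => h

theorem HasTree.inst {Γ : List ClosedType} {M N : Term} {σ : ClosedType} {t : TypeTree}
    (hM : HasTree (σ :: Γ) M t) (hN : HasTree Γ N σ.toTree) : HasTree Γ (M.inst N) t := by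
  refine hM.subst ?_
  rintro (_ | i) τ hτ
  · cases hτ
    exact hN
  · exact ⟨τ, hτ, rfl⟩

/-- Subject reduction. -/
theorem HasTree.red {Γ : List ClosedType} {M N : Term} {t : TypeTree} (h : HasTree Γ M t)
    (hr : Red M N) : HasTree Γ N t := by
  induction hr generalizing Γ t with
  | beta σ M N =>
    obtain ⟨s, ⟨u, hM, e⟩, hN⟩ := h
    obtain ⟨-, rfl, rfl⟩ := TypeTree.bin_inj.1 e
    exact hM.inst hN
  | appLeft _ _ ih =>
    obtain ⟨s, hM, hN⟩ := h
    exact ⟨s, ih hM, hN⟩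
  | appRight _ _ ih =>
    obtain ⟨s, hM, hN⟩ := h
    exact ⟨s, hM, ih hN⟩
  | lam _ _ ih =>
    obtain ⟨s, hM, h⟩ := h
    exact ⟨s, ih hM, h⟩
  -- For the constant rules, injectivity of the type constructors identifies the subscripts of the
  -- constants that meet in a redex.
  | _ =>
    simp [HasTree, Const.ctype, TypeTree.bin_inj] at h ⊢
    grind

/-! ## Algebra of substitutions -/

namespace Term

/-- Renamings are substitutions by indices. The composition laws below are built up in order,
because going under a binder in one uses earlier laws for the shifted entries. -/
theorem rename_eq_subst (f : ℕ → ℕ) (M : Term) : M.rename f = M.subst fun i => bvar (f i) := by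
  induction M generalizing f with
  | lam σ M ih =>
    simp only [rename, subst, ih]
    congr 2
    funext i
    cases i <;> rfl
  | _ => simp_all [rename, subst]

theorem subst_rename (f : ℕ → ℕ) (s : ℕ → Term) (M : Term) :
    (M.rename f).subst s = M.subst fun i => s (f i) := by
  induction M generalizing f s with
  | lam σ M ih =>
    simp only [rename, subst, ih]
    congr 2
    funext i
    cases i <;> rfl
  | _ => simp_all [rename, subst]

theorem rename_rename (f g : ℕ → ℕ) (M : Term) :
    (M.rename f).rename g = M.rename fun i => g (f i) := by
  rw [rename_eq_subst g, subst_rename, ← rename_eq_subst fun i => g (f i)]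

theorem rename_subst (s : ℕ → Term) (f : ℕ → ℕ) (M : Term) :
    (M.subst s).rename f = M.subst fun i => (s i).rename f := by
  induction M generalizing f s with
  | lam σ M ih =>
    simp only [rename, subst, ih]
    congr 2
    funext i
    cases i
    · rfl
    · simp only [upSub, rename_rename]
      rfl
  | _ => simp_all [rename, subst]

theorem subst_subst (s r : ℕ → Term) (M : Term) :
    (M.subst s).subst r = M.subst fun i => (s i).subst r := by
  induction M generalizing s r with
  | lam σ M ih =>
    simp only [subst, ih]
    congr 2
    funext i
    cases i
    · rfl
    · simp only [upSub, subst_rename, rename_subst]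
  | _ => simp_all [subst]

theorem subst_bvar (M : Term) : M.subst bvar = M := by
  induction M with
  | lam σ M ih =>
    have : upSub bvar = bvar := by
      funext i
      cases i <;> rfl
    simp [subst, this, ih]
  | _ => simp_all [subst]

/-- The substitution lemma: it keeps β-redexes stable under substitution. -/
theorem inst_subst (M N : Term) (s : ℕ → Term) :
    (M.inst N).subst s = (M.subst (upSub s)).inst (N.subst s) := by
  simp only [inst, subst_subst]
  congr 1
  funext i
  cases i
  · rfl
  · simp only [upSub, subst_rename, single, subst]
    exact (subst_bvar _).symm

theorem inst_rename (M N : Term) (f : ℕ → ℕ) :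
    (M.inst N).rename f = (M.rename (upRen f)).inst (N.rename f) := by
  have : (fun i => bvar (upRen f i)) = upSub fun i => bvar (f i) := by
    funext i
    cases i <;> rfl
  simp only [rename_eq_subst, inst_subst, this]

end Term

/-! ## Parallel reduction -/

open Term

/-- Parallel reduction: a set of redexes of a term is contracted at once. -/
inductive Par : Term → Term → Prop
  | fvar (σ : ClosedType) (n : ℕ) : Par (fvar σ n) (fvar σ n)
  | bvar (i : ℕ) : Par (bvar i) (bvar i)
  | const (c : Const) : Par (const c) (const c)
  | app {M M' N N' : Term} : Par M M' → Par N N' → Par (app M N) (app M' N')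
  | lam (σ : ClosedType) {M M' : Term} : Par M M' → Par (lam σ M) (lam σ M')
  | beta (σ : ClosedType) {M M' N N' : Term} :
      Par M M' → Par N N' → Par (app (lam σ M) N) (M'.inst N')
  | case_zero (σ τ ρ σ' τ' : TypeTree) {x x' y y' : Term} (z : Term) : Par x x' → Par y y' →
      Par (app3 (.scase σ τ ρ) (app1 (.zero σ' τ') x) y z) (app y' x')
  | case_one (σ τ ρ σ' τ' : TypeTree) {x x' : Term} (y : Term) {z z' : Term} :
      Par x x' → Par z z' →
      Par (app3 (.scase σ τ ρ) (app1 (.one σ' τ') x) y z) (app z' x')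
  | fst_pair (σ τ σ' τ' : TypeTree) {x x' : Term} (y : Term) : Par x x' →
      Par (app1 (.fst σ τ) (app2 (.pair σ' τ') x y)) x'
  | snd_pair (σ τ σ' τ' : TypeTree) (x : Term) {y y' : Term} : Par y y' →
      Par (app1 (.snd σ τ) (app2 (.pair σ' τ') x y)) y'
  | pcase_zero (σ τ ρ σ' τ' : TypeTree) (x : Term) {y y' : Term} (z : Term) : Par y y' →
      Par (app3 (.pcase σ τ ρ) (app1 (.zero σ' τ') x) y z) y'
  | pcase_one (σ τ ρ σ' τ' : TypeTree) (x y : Term) {z z' : Term} : Par z z' →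
      Par (app3 (.pcase σ τ ρ) (app1 (.one σ' τ') x) y z) z'
  -- `TypeTree.bin` is not a constructor, so the shape of `ρ` is an equation and case analysis need
  -- not unify with it.
  | pcase_zero_zero (σ τ : TypeTree) {ρ ρ₀ ρ₁ : TypeTree} (σ' τ' σ'' τ'' : TypeTree)
      {x x' y y' z z' : Term} : ρ = .sum ρ₀ ρ₁ → Par x x' → Par y y' → Par z z' →
      Par (app3 (.pcase σ τ ρ) x (app1 (.zero σ' τ') y) (app1 (.zero σ'' τ'') z))
        (app1 (.zero ρ₀ ρ₁) (app3 (.pcase σ τ ρ₀) x' y' z'))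
  | pcase_one_one (σ τ : TypeTree) {ρ ρ₀ ρ₁ : TypeTree} (σ' τ' σ'' τ'' : TypeTree)
      {x x' y y' z z' : Term} : ρ = .sum ρ₀ ρ₁ → Par x x' → Par y y' → Par z z' →
      Par (app3 (.pcase σ τ ρ) x (app1 (.one σ' τ') y) (app1 (.one σ'' τ'') z))
        (app1 (.one ρ₀ ρ₁) (app3 (.pcase σ τ ρ₁) x' y' z'))
  | pcase_pair_pair (σ τ : TypeTree) {ρ ρ₁ ρ₂ : TypeTree} (σ' τ' σ'' τ'' : TypeTree)
      {x x' y₁ y₁' y₂ y₂' z₁ z₁' z₂ z₂' : Term} : ρ = .prod ρ₁ ρ₂ → Par x x' →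
      Par y₁ y₁' → Par y₂ y₂' → Par z₁ z₁' → Par z₂ z₂' →
      Par (app3 (.pcase σ τ ρ) x (app2 (.pair σ' τ') y₁ y₂) (app2 (.pair σ'' τ'') z₁ z₂))
        (app2 (.pair ρ₁ ρ₂) (app3 (.pcase σ τ ρ₁) x' y₁' z₁') (app3 (.pcase σ τ ρ₂) x' y₂' z₂'))
  | pcase_arr (σ τ : TypeTree) {ρ ρ₁ ρ₂ : TypeTree} {x x' y y' z z' w w' : Term} :
      ρ = .arr ρ₁ ρ₂ → Par x x' → Par y y' → Par z z' → Par w w' →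
      Par (app (app3 (.pcase σ τ ρ) x y z) w) (app3 (.pcase σ τ ρ₂) x' (app y' w') (app z' w'))

namespace Par

theorem refl (M : Term) : Par M M := by
  induction M with
  | fvar σ n => exact .fvar σ n
  | bvar i => exact .bvar i
  | const c => exact .const c
  | app M N ihM ihN => exact .app ihM ihN
  | lam σ M ih => exact .lam σ ih

theorem of_red {M N : Term} (h : Red M N) : Par M N := by
  induction h with
  | appLeft N _ ih => exact .app ih (refl N)
  | appRight M _ ih => exact .app (refl M) ih
  | lam σ _ ih => exact .lam σ ih
  | beta σ M N => exact .beta σ (refl M) (refl N)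
  | case_zero => exact .case_zero _ _ _ _ _ _ (refl _) (refl _)
  | case_one => exact .case_one _ _ _ _ _ _ (refl _) (refl _)
  | fst_pair => exact .fst_pair _ _ _ _ _ (refl _)
  | snd_pair => exact .snd_pair _ _ _ _ _ (refl _)
  | pcase_zero => exact .pcase_zero _ _ _ _ _ _ _ (refl _)
  | pcase_one => exact .pcase_one _ _ _ _ _ _ _ (refl _)
  | pcase_zero_zero => exact .pcase_zero_zero _ _ _ _ _ _ rfl (refl _) (refl _) (refl _)
  | pcase_one_one => exact .pcase_one_one _ _ _ _ _ _ rfl (refl _) (refl _) (refl _)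
  | pcase_pair_pair => exact .pcase_pair_pair _ _ _ _ _ _ rfl (refl _) (refl _) (refl _) (refl _) (refl _)
  | pcase_arr => exact .pcase_arr _ _ rfl (refl _) (refl _) (refl _) (refl _)

theorem rename (f : ℕ → ℕ) {M M' : Term} (h : Par M M') : Par (M.rename f) (M'.rename f) := by
  induction h generalizing f with
  | beta σ _ _ ihM ihN =>
    rw [inst_rename]
    exact .beta σ (ihM _) (ihN f)
  | lam σ _ ih => exact .lam σ (ih _)
  | fvar | bvar | const => exact refl _
  | app _ _ ih₁ ih₂ => exact .app (ih₁ f) (ih₂ f)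
  | case_zero _ _ _ _ _ _ _ _ ih₁ ih₂ =>
    exact .case_zero _ _ _ _ _ _ (ih₁ f) (ih₂ f)
  | case_one _ _ _ _ _ _ _ _ ih₁ ih₂ =>
    exact .case_one _ _ _ _ _ _ (ih₁ f) (ih₂ f)
  | fst_pair _ _ _ _ _ _ ih₁ =>
    exact .fst_pair _ _ _ _ _ (ih₁ f)
  | snd_pair _ _ _ _ _ _ ih₁ =>
    exact .snd_pair _ _ _ _ _ (ih₁ f)
  | pcase_zero _ _ _ _ _ _ _ _ ih₁ =>
    exact .pcase_zero _ _ _ _ _ _ _ (ih₁ f)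
  | pcase_one _ _ _ _ _ _ _ _ ih₁ =>
    exact .pcase_one _ _ _ _ _ _ _ (ih₁ f)
  | pcase_zero_zero _ _ _ _ _ _ e _ _ _ ih₁ ih₂ ih₃ =>
    exact .pcase_zero_zero _ _ _ _ _ _ e (ih₁ f) (ih₂ f) (ih₃ f)
  | pcase_one_one _ _ _ _ _ _ e _ _ _ ih₁ ih₂ ih₃ =>
    exact .pcase_one_one _ _ _ _ _ _ e (ih₁ f) (ih₂ f) (ih₃ f)
  | pcase_pair_pair _ _ _ _ _ _ e _ _ _ _ _ ih₁ ih₂ ih₃ ih₄ ih₅ =>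
    exact .pcase_pair_pair _ _ _ _ _ _ e (ih₁ f) (ih₂ f) (ih₃ f) (ih₄ f) (ih₅ f)
  | pcase_arr _ _ e _ _ _ _ ih₁ ih₂ ih₃ ih₄ =>
    exact .pcase_arr _ _ e (ih₁ f) (ih₂ f) (ih₃ f) (ih₄ f)

/-- Body and substituted terms reduce at the same time, as is needed when a β-redex is contracted
after both of its parts were reduced. -/
theorem subst {s s' : ℕ → Term} {M M' : Term} (h : Par M M') (hs : ∀ i, Par (s i) (s' i)) :
    Par (M.subst s) (M'.subst s') := by
  have up : ∀ {s s' : ℕ → Term}, (∀ i, Par (s i) (s' i)) → ∀ i, Par (upSub s i) (upSub s' i) := by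
    rintro s s' hs (_ | i)
    · exact .bvar 0
    · exact (hs i).rename _
  induction h generalizing s s' with
  | beta σ _ _ ihM ihN =>
    rw [inst_subst]
    exact .beta σ (ihM (up hs)) (ihN hs)
  | lam σ _ ih => exact .lam σ (ih (up hs))
  | bvar i => exact hs i
  | fvar | const => exact refl _
  | app _ _ ih₁ ih₂ => exact .app (ih₁ hs) (ih₂ hs)
  | case_zero _ _ _ _ _ _ _ _ ih₁ ih₂ =>
    exact .case_zero _ _ _ _ _ _ (ih₁ hs) (ih₂ hs)
  | case_one _ _ _ _ _ _ _ _ ih₁ ih₂ =>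
    exact .case_one _ _ _ _ _ _ (ih₁ hs) (ih₂ hs)
  | fst_pair _ _ _ _ _ _ ih₁ =>
    exact .fst_pair _ _ _ _ _ (ih₁ hs)
  | snd_pair _ _ _ _ _ _ ih₁ =>
    exact .snd_pair _ _ _ _ _ (ih₁ hs)
  | pcase_zero _ _ _ _ _ _ _ _ ih₁ =>
    exact .pcase_zero _ _ _ _ _ _ _ (ih₁ hs)
  | pcase_one _ _ _ _ _ _ _ _ ih₁ =>
    exact .pcase_one _ _ _ _ _ _ _ (ih₁ hs)
  | pcase_zero_zero _ _ _ _ _ _ e _ _ _ ih₁ ih₂ ih₃ =>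
    exact .pcase_zero_zero _ _ _ _ _ _ e (ih₁ hs) (ih₂ hs) (ih₃ hs)
  | pcase_one_one _ _ _ _ _ _ e _ _ _ ih₁ ih₂ ih₃ =>
    exact .pcase_one_one _ _ _ _ _ _ e (ih₁ hs) (ih₂ hs) (ih₃ hs)
  | pcase_pair_pair _ _ _ _ _ _ e _ _ _ _ _ ih₁ ih₂ ih₃ ih₄ ih₅ =>
    exact .pcase_pair_pair _ _ _ _ _ _ e (ih₁ hs) (ih₂ hs) (ih₃ hs) (ih₄ hs) (ih₅ hs)
  | pcase_arr _ _ e _ _ _ _ ih₁ ih₂ ih₃ ih₄ =>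
    exact .pcase_arr _ _ e (ih₁ hs) (ih₂ hs) (ih₃ hs) (ih₄ hs)

theorem inst {M M' N N' : Term} (hM : Par M M') (hN : Par N N') :
    Par (M.inst N) (M'.inst N') := by
  refine hM.subst ?_
  rintro (_ | i)
  · exact hN
  · exact .bvar i

end Par

theorem Reds.app {M M' N N' : Term} (hM : Reds M M') (hN : Reds N N') :
    Reds (app M N) (app M' N') :=
  (Relation.ReflTransGen.lift (fun x => Term.app x N) (fun _ _ h => Red.appLeft N h) _ _ hM).trans
    (Relation.ReflTransGen.lift (fun x => Term.app M' x) (fun _ _ h => Red.appRight M' h) _ _ hN)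

theorem Reds.lam (σ : ClosedType) {M M' : Term} (h : Reds M M') :
    Reds (lam σ M) (lam σ M') :=
  Relation.ReflTransGen.lift (Term.lam σ) (fun _ _ h => Red.lam σ h) _ _ h

theorem Reds.refl (M : Term) : Reds M M := Relation.ReflTransGen.refl

/-- For β the parts are reduced before the contraction. For the constant rules the contraction comes
first, so discarded arguments stay untouched. -/
theorem Par.reds {M N : Term} (h : Par M N) : Reds M N := by
  induction h with
  | fvar | bvar | const => exact .refl _
  | app _ _ ihM ihN => exact ihM.app ihN
  | lam σ _ ih => exact ih.lam σ
  | beta σ _ _ ihM ihN => exact ((ihM.lam σ).app ihN).tail (.beta ..)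
  | case_zero _ _ _ _ _ _ _ _ ihx ihy => exact .head (.case_zero ..) (ihy.app ihx)
  | case_one _ _ _ _ _ _ _ _ ihx ihz => exact .head (.case_one ..) (ihz.app ihx)
  | fst_pair _ _ _ _ _ _ ih => exact .head (.fst_pair ..) ih
  | snd_pair _ _ _ _ _ _ ih => exact .head (.snd_pair ..) ih
  | pcase_zero _ _ _ _ _ _ _ _ ih => exact .head (.pcase_zero ..) ih
  | pcase_one _ _ _ _ _ _ _ _ ih => exact .head (.pcase_one ..) ih
  | pcase_zero_zero _ _ _ _ _ _ e _ _ _ ihx ihy ihz =>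
    subst e
    exact .head (.pcase_zero_zero ..)
      (Reds.app (.refl _) (.app (.app (.app (.refl _) ihx) ihy) ihz))
  | pcase_one_one _ _ _ _ _ _ e _ _ _ ihx ihy ihz =>
    subst e
    exact .head (.pcase_one_one ..)
      (Reds.app (.refl _) (.app (.app (.app (.refl _) ihx) ihy) ihz))
  | pcase_pair_pair _ _ _ _ _ _ e _ _ _ _ _ ihx ihy₁ ihy₂ ihz₁ ihz₂ =>
    subst e
    exact .head (.pcase_pair_pair ..)
      (Reds.app (.app (.refl _) (.app (.app (.app (.refl _) ihx) ihy₁) ihz₁))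
        (Reds.app (.app (.app (.refl _) ihx) ihy₂) ihz₂))
  | pcase_arr _ _ e _ _ _ _ ihx ihy ihz ihw =>
    subst e
    exact .head (.pcase_arr ..)
      (Reds.app (.app (.app (.refl _) ihx) (ihy.app ihw)) (ihz.app ihw))

theorem HasTree.reds {Γ : List ClosedType} {M N : Term} {t : TypeTree} (h : HasTree Γ M t)
    (hr : Reds M N) : HasTree Γ N t := by
  induction hr with
  | refl => exact h
  | tail _ hr ih => exact ih.red hr

theorem HasTree.par {Γ : List ClosedType} {M N : Term} {t : TypeTree} (h : HasTree Γ M t)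
    (hr : Par M N) : HasTree Γ N t := h.reds hr.reds

/-! ### Inversion of parallel reduction and of typing -/

namespace Par

/-- No left-hand side has this head with this number of arguments, so only the arguments can reduce;
likewise for the inversions that follow. -/
theorem zero_inv {σ τ : TypeTree} {x N : Term} (h : Par (app1 (.zero σ τ) x) N) :
    ∃ x', N = app1 (.zero σ τ) x' ∧ Par x x' := by
  cases h with
  | app h hx => cases h; exact ⟨_, rfl, hx⟩

theorem one_inv {σ τ : TypeTree} {x N : Term} (h : Par (app1 (.one σ τ) x) N) :
    ∃ x', N = app1 (.one σ τ) x' ∧ Par x x' := by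
  cases h with
  | app h hx => cases h; exact ⟨_, rfl, hx⟩

theorem pair_inv {σ τ : TypeTree} {x y N : Term} (h : Par (app2 (.pair σ τ) x y) N) :
    ∃ x' y', N = app2 (.pair σ τ) x' y' ∧ Par x x' ∧ Par y y' := by
  cases h with
  | app h hy => cases h with
    | app h hx => cases h; exact ⟨_, _, rfl, hx, hy⟩

theorem scase_inv {σ τ ρ : TypeTree} {x y N : Term} (h : Par (app2 (.scase σ τ ρ) x y) N) :
    ∃ x' y', N = app2 (.scase σ τ ρ) x' y' ∧ Par x x' ∧ Par y y' := by
  cases h with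
  | app h hy => cases h with
    | app h hx => cases h; exact ⟨_, _, rfl, hx, hy⟩

theorem pcase_inv {σ τ ρ : TypeTree} {x y N : Term} (h : Par (app2 (.pcase σ τ ρ) x y) N) :
    ∃ x' y', N = app2 (.pcase σ τ ρ) x' y' ∧ Par x x' ∧ Par y y' := by
  cases h with
  | app h hy => cases h with
    | app h hx => cases h; exact ⟨_, _, rfl, hx, hy⟩

theorem app2 (c : Const) {x x' y y' : Term} (hx : Par x x') (hy : Par y y') :
    Par (app2 c x y) (app2 c x' y') :=
  .app (.app (.const c) hx) hy

theorem app3 (c : Const) {x x' y y' z z' : Term} (hx : Par x x') (hy : Par y y')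
    (hz : Par z z') : Par (app3 c x y z) (app3 c x' y' z') :=
  .app (.app2 c hx hy) hz

end Par

/-- The argument types of a typed application of `pcase`. -/
theorem HasTree.pcase_inv {Γ : List ClosedType} {σ τ ρ t : TypeTree} {x y z : Term}
    (h : HasTree Γ (app3 (.pcase σ τ ρ) x y z) t) :
    HasTree Γ x (.sum σ τ) ∧ HasTree Γ y ρ ∧ HasTree Γ z ρ := by
  simp [HasTree, Const.ctype, TypeTree.bin_inj] at h
  exact ⟨h.1.1.2, h.1.2, h.2⟩

theorem HasTree.zero_inv {Γ : List ClosedType} {σ τ t : TypeTree} {x : Term}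
    (h : HasTree Γ (app1 (.zero σ τ) x) t) : t = .sum σ τ ∧ HasTree Γ x σ := by
  simpa [HasTree, Const.ctype, TypeTree.bin_inj] using h

theorem HasTree.one_inv {Γ : List ClosedType} {σ τ t : TypeTree} {x : Term}
    (h : HasTree Γ (app1 (.one σ τ) x) t) : t = .sum σ τ ∧ HasTree Γ x τ := by
  simpa [HasTree, Const.ctype, TypeTree.bin_inj] using h

theorem HasTree.pair_inv {Γ : List ClosedType} {σ τ t : TypeTree} {x y : Term}
    (h : HasTree Γ (app2 (.pair σ τ) x y) t) :
    t = .prod σ τ ∧ HasTree Γ x σ ∧ HasTree Γ y τ := by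
  simpa [HasTree, Const.ctype, TypeTree.bin_inj, and_assoc] using h

/-! ### Complete developments -/

/-- `M'` is a complete development of `M`: every parallel reduct of `M` reduces to it. -/
def IsDev (M M' : Term) : Prop := ∀ N, Par M N → Par N M'

namespace IsDev

theorem lam (σ : ClosedType) {M M' : Term} (h : IsDev M M') : IsDev (lam σ M) (lam σ M') := by
  intro N hN
  cases hN with
  | lam _ hN => exact .lam σ (h _ hN)

/-- A reduct either still shows the redex, which is contracted now, or has contracted it, and then
only its parts go on. The `case`, `fst` and `snd` rules follow the same pattern. -/
theorem beta (σ : ClosedType) {M M' N N' : Term} (hM : IsDev M M') (hN : IsDev N N') :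
    IsDev (app (.lam σ M) N) (M'.inst N') := by
  intro K hK
  cases hK with
  | app h1 h2 => cases h1 with
    | lam _ h1 => exact .beta σ (hM _ h1) (hN _ h2)
  | beta _ h1 h2 => exact (hM _ h1).inst (hN _ h2)

theorem case_zero (σ τ ρ σ' τ' : TypeTree) {x x' y y' : Term} (z : Term) (hx : IsDev x x')
    (hy : IsDev y y') : IsDev (app3 (.scase σ τ ρ) (app1 (.zero σ' τ') x) y z) (app y' x') := by
  intro K hK
  cases hK with
  | app h1 h2 =>
    obtain ⟨_, y₁, rfl, h3, h4⟩ := h1.scase_inv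
    obtain ⟨x₁, rfl, h5⟩ := h3.zero_inv
    exact .case_zero _ _ _ _ _ _ (hx _ h5) (hy _ h4)
  | case_zero _ _ _ _ _ _ h1 h2 => exact .app (hy _ h2) (hx _ h1)

theorem case_one (σ τ ρ σ' τ' : TypeTree) {x x' z z' : Term} (y : Term) (hx : IsDev x x')
    (hz : IsDev z z') : IsDev (app3 (.scase σ τ ρ) (app1 (.one σ' τ') x) y z) (app z' x') := by
  intro K hK
  cases hK with
  | app h1 h2 =>
    obtain ⟨_, y₁, rfl, h3, h4⟩ := h1.scase_inv
    obtain ⟨x₁, rfl, h5⟩ := h3.one_inv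
    exact .case_one _ _ _ _ _ _ (hx _ h5) (hz _ h2)
  | case_one _ _ _ _ _ _ h1 h2 => exact .app (hz _ h2) (hx _ h1)

theorem fst_pair (σ τ σ' τ' : TypeTree) {x x' : Term} (y : Term) (hx : IsDev x x') :
    IsDev (app1 (.fst σ τ) (app2 (.pair σ' τ') x y)) x' := by
  intro K hK
  cases hK with
  | app h1 h2 =>
    cases h1
    obtain ⟨x₁, y₁, rfl, h3, h4⟩ := h2.pair_inv
    exact .fst_pair _ _ _ _ _ (hx _ h3)
  | fst_pair _ _ _ _ _ h1 => exact hx _ h1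

theorem snd_pair (σ τ σ' τ' : TypeTree) (x : Term) {y y' : Term} (hy : IsDev y y') :
    IsDev (app1 (.snd σ τ) (app2 (.pair σ' τ') x y)) y' := by
  intro K hK
  cases hK with
  | app h1 h2 =>
    cases h1
    obtain ⟨x₁, y₁, rfl, h3, h4⟩ := h2.pair_inv
    exact .snd_pair _ _ _ _ _ (hy _ h4)
  | snd_pair _ _ _ _ _ h1 => exact hy _ h1

/-- The critical overlap: a structural rule may have pushed `pcase` inside `0`, `1` or `pair`, and
selecting the branch there must rebuild a reduct of `y`. -/
theorem pcase_zero {Γ : List ClosedType} {t σ τ ρ σ' τ' : TypeTree} {x y y' z : Term}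
    (ht : HasTree Γ (app3 (.pcase σ τ ρ) (app1 (.zero σ' τ') x) y z) t) (hy : IsDev y y') :
    IsDev (app3 (.pcase σ τ ρ) (app1 (.zero σ' τ') x) y z) y' := by
  obtain ⟨-, hty, -⟩ := ht.pcase_inv
  intro K hK
  cases hK with
  | app h1 h2 =>
    obtain ⟨_, y₁, rfl, h3, h4⟩ := h1.pcase_inv
    obtain ⟨x₁, rfl, h5⟩ := h3.zero_inv
    exact .pcase_zero _ _ _ _ _ _ _ (hy _ h4)
  | pcase_zero _ _ _ _ _ _ _ h1 => exact hy _ h1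
  | pcase_zero_zero _ _ σ₁ τ₁ _ _ e h1 h2 h3 =>
    -- By typing, the branch has type `ρ`, so the subscripts of its `0` are those of the `0` made by
    -- the rule.
    obtain ⟨-, rfl, rfl⟩ := TypeTree.bin_inj.1 (e.symm.trans hty.zero_inv.1)
    obtain ⟨x₁, rfl, -⟩ := h1.zero_inv
    -- The development of `0 y` is a parallel reduct of a term `0 _`, so it starts with the same
    -- `0`.
    obtain ⟨y₁, rfl, h4⟩ := (hy _ (.app (.refl _) h2)).zero_inv
    exact .app (.refl _) (.pcase_zero _ _ _ _ _ _ _ h4)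
  | pcase_one_one _ _ σ₁ τ₁ _ _ e h1 h2 h3 =>
    obtain ⟨-, rfl, rfl⟩ := TypeTree.bin_inj.1 (e.symm.trans hty.one_inv.1)
    obtain ⟨x₁, rfl, -⟩ := h1.zero_inv
    obtain ⟨y₁, rfl, h4⟩ := (hy _ (.app (.refl _) h2)).one_inv
    exact .app (.refl _) (.pcase_zero _ _ _ _ _ _ _ h4)
  | pcase_pair_pair _ _ σ₁ τ₁ _ _ e h1 h2 h3 h4 h5 =>
    obtain ⟨-, rfl, rfl⟩ := TypeTree.bin_inj.1 (e.symm.trans hty.pair_inv.1)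
    obtain ⟨x₁, rfl, -⟩ := h1.zero_inv
    obtain ⟨y₁, y₂, rfl, h6, h7⟩ := (hy _ (.app2 _ h2 h3)).pair_inv
    exact .app2 _ (.pcase_zero _ _ _ _ _ _ _ h6) (.pcase_zero _ _ _ _ _ _ _ h7)

theorem pcase_one {Γ : List ClosedType} {t σ τ ρ σ' τ' : TypeTree} {x y z z' : Term}
    (ht : HasTree Γ (app3 (.pcase σ τ ρ) (app1 (.one σ' τ') x) y z) t) (hz : IsDev z z') :
    IsDev (app3 (.pcase σ τ ρ) (app1 (.one σ' τ') x) y z) z' := by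
  obtain ⟨-, -, htz⟩ := ht.pcase_inv
  intro K hK
  cases hK with
  | app h1 h2 =>
    obtain ⟨_, y₁, rfl, h3, h4⟩ := h1.pcase_inv
    obtain ⟨x₁, rfl, h5⟩ := h3.one_inv
    exact .pcase_one _ _ _ _ _ _ _ (hz _ h2)
  | pcase_one _ _ _ _ _ _ _ h1 => exact hz _ h1
  | pcase_zero_zero _ _ _ _ σ₁ τ₁ e h1 h2 h3 =>
    obtain ⟨-, rfl, rfl⟩ := TypeTree.bin_inj.1 (e.symm.trans htz.zero_inv.1)
    obtain ⟨x₁, rfl, -⟩ := h1.one_inv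
    obtain ⟨z₁, rfl, h4⟩ := (hz _ (.app (.refl _) h3)).zero_inv
    exact .app (.refl _) (.pcase_one _ _ _ _ _ _ _ h4)
  | pcase_one_one _ _ _ _ σ₁ τ₁ e h1 h2 h3 =>
    obtain ⟨-, rfl, rfl⟩ := TypeTree.bin_inj.1 (e.symm.trans htz.one_inv.1)
    obtain ⟨x₁, rfl, -⟩ := h1.one_inv
    obtain ⟨z₁, rfl, h4⟩ := (hz _ (.app (.refl _) h3)).one_inv
    exact .app (.refl _) (.pcase_one _ _ _ _ _ _ _ h4)
  | pcase_pair_pair _ _ _ _ σ₁ τ₁ e h1 h2 h3 h4 h5 =>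
    obtain ⟨-, rfl, rfl⟩ := TypeTree.bin_inj.1 (e.symm.trans htz.pair_inv.1)
    obtain ⟨x₁, rfl, -⟩ := h1.one_inv
    obtain ⟨z₁, z₂, rfl, h6, h7⟩ := (hz _ (.app2 _ h4 h5)).pair_inv
    exact .app2 _ (.pcase_one _ _ _ _ _ _ _ h6) (.pcase_one _ _ _ _ _ _ _ h7)

end IsDev

/-- `x` is of the form `0 y` or `1 y`. -/
def Term.IsInjection (x : Term) : Prop :=
  ∃ σ τ y, x = app1 (.zero σ τ) y ∨ x = app1 (.one σ τ) y

theorem Term.isInjection_zero (σ τ : TypeTree) (y : Term) : (app1 (.zero σ τ) y).IsInjection :=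
  ⟨σ, τ, y, .inl rfl⟩

theorem Term.isInjection_one (σ τ : TypeTree) (y : Term) : (app1 (.one σ τ) y).IsInjection :=
  ⟨σ, τ, y, .inr rfl⟩

namespace IsDev

/-- Excluding injections as first argument removes the overlap with branch selection; the remaining
subscripts are fixed by `ρ` alone, without typing. The same holds for the next two rules. -/
theorem pcase_zero_zero (σ τ : TypeTree) {ρ ρ₀ ρ₁ : TypeTree} (σ' τ' σ'' τ'' : TypeTree)
    {x x' y y' z z' : Term} (e : ρ = .sum ρ₀ ρ₁) (hi : ¬ x.IsInjection) (hx : IsDev x x')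
    (hy : IsDev y y') (hz : IsDev z z') :
    IsDev (app3 (.pcase σ τ ρ) x (app1 (.zero σ' τ') y) (app1 (.zero σ'' τ'') z))
      (app1 (.zero ρ₀ ρ₁) (app3 (.pcase σ τ ρ₀) x' y' z')) := by
  intro K hK
  cases hK with
  | app h1 h2 =>
    obtain ⟨x₁, _, rfl, h3, h4⟩ := h1.pcase_inv
    obtain ⟨y₁, rfl, h5⟩ := h4.zero_inv
    obtain ⟨z₁, rfl, h6⟩ := h2.zero_inv
    exact .pcase_zero_zero _ _ _ _ _ _ e (hx _ h3) (hy _ h5) (hz _ h6)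
  | pcase_zero => exact absurd (isInjection_zero ..) hi
  | pcase_one => exact absurd (isInjection_one ..) hi
  | pcase_zero_zero _ _ _ _ _ _ e' h1 h2 h3 =>
    obtain ⟨-, rfl, rfl⟩ := TypeTree.bin_inj.1 (e.symm.trans e')
    exact .app (.refl _) (.app3 _ (hx _ h1) (hy _ h2) (hz _ h3))

theorem pcase_one_one (σ τ : TypeTree) {ρ ρ₀ ρ₁ : TypeTree} (σ' τ' σ'' τ'' : TypeTree)
    {x x' y y' z z' : Term} (e : ρ = .sum ρ₀ ρ₁) (hi : ¬ x.IsInjection) (hx : IsDev x x')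
    (hy : IsDev y y') (hz : IsDev z z') :
    IsDev (app3 (.pcase σ τ ρ) x (app1 (.one σ' τ') y) (app1 (.one σ'' τ'') z))
      (app1 (.one ρ₀ ρ₁) (app3 (.pcase σ τ ρ₁) x' y' z')) := by
  intro K hK
  cases hK with
  | app h1 h2 =>
    obtain ⟨x₁, _, rfl, h3, h4⟩ := h1.pcase_inv
    obtain ⟨y₁, rfl, h5⟩ := h4.one_inv
    obtain ⟨z₁, rfl, h6⟩ := h2.one_inv
    exact .pcase_one_one _ _ _ _ _ _ e (hx _ h3) (hy _ h5) (hz _ h6)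
  | pcase_zero => exact absurd (isInjection_zero ..) hi
  | pcase_one => exact absurd (isInjection_one ..) hi
  | pcase_one_one _ _ _ _ _ _ e' h1 h2 h3 =>
    obtain ⟨-, rfl, rfl⟩ := TypeTree.bin_inj.1 (e.symm.trans e')
    exact .app (.refl _) (.app3 _ (hx _ h1) (hy _ h2) (hz _ h3))

theorem pcase_pair_pair (σ τ : TypeTree) {ρ ρ₁ ρ₂ : TypeTree} (σ' τ' σ'' τ'' : TypeTree)
    {x x' y₁ y₁' y₂ y₂' z₁ z₁' z₂ z₂' : Term} (e : ρ = .prod ρ₁ ρ₂) (hi : ¬ x.IsInjection)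
    (hx : IsDev x x') (hy₁ : IsDev y₁ y₁') (hy₂ : IsDev y₂ y₂') (hz₁ : IsDev z₁ z₁')
    (hz₂ : IsDev z₂ z₂') :
    IsDev (app3 (.pcase σ τ ρ) x (app2 (.pair σ' τ') y₁ y₂) (app2 (.pair σ'' τ'') z₁ z₂))
      (app2 (.pair ρ₁ ρ₂) (app3 (.pcase σ τ ρ₁) x' y₁' z₁')
        (app3 (.pcase σ τ ρ₂) x' y₂' z₂')) := by
  intro K hK
  cases hK with
  | app h1 h2 =>
    obtain ⟨x₁, _, rfl, h3, h4⟩ := h1.pcase_inv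
    obtain ⟨_, _, rfl, h5, h6⟩ := h4.pair_inv
    obtain ⟨_, _, rfl, h7, h8⟩ := h2.pair_inv
    exact .pcase_pair_pair _ _ _ _ _ _ e (hx _ h3) (hy₁ _ h5) (hy₂ _ h6) (hz₁ _ h7) (hz₂ _ h8)
  | pcase_zero => exact absurd (isInjection_zero ..) hi
  | pcase_one => exact absurd (isInjection_one ..) hi
  | pcase_pair_pair _ _ _ _ _ _ e' h1 h2 h3 h4 h5 =>
    obtain ⟨-, rfl, rfl⟩ := TypeTree.bin_inj.1 (e.symm.trans e')
    exact .app2 _ (.app3 _ (hx _ h1) (hy₁ _ h2) (hz₁ _ h4))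
      (.app3 _ (hx _ h1) (hy₂ _ h3) (hz₂ _ h5))

/-- The inner `pcase x y z` could itself be a redex, but `x` is no injection, and the structural
rules for sums and products clash with the arrow `ρ`. -/
theorem pcase_arr (σ τ : TypeTree) {ρ ρ₁ ρ₂ : TypeTree} {x x' y y' z z' w w' : Term}
    (e : ρ = .arr ρ₁ ρ₂) (hi : ¬ x.IsInjection) (hx : IsDev x x') (hy : IsDev y y')
    (hz : IsDev z z') (hw : IsDev w w') :
    IsDev (app (app3 (.pcase σ τ ρ) x y z) w)
      (app3 (.pcase σ τ ρ₂) x' (app y' w') (app z' w')) := by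
  intro K hK
  cases hK with
  | app h1 h2 =>
    cases h1 with
    | app h1 h6 =>
      obtain ⟨x₁, y₁, rfl, h3, h4⟩ := h1.pcase_inv
      exact .pcase_arr _ _ e (hx _ h3) (hy _ h4) (hz _ h6) (hw _ h2)
    | pcase_zero => exact absurd (isInjection_zero ..) hi
    | pcase_one => exact absurd (isInjection_one ..) hi
    | pcase_zero_zero _ _ _ _ _ _ e' => cases (TypeTree.bin_inj.1 (e.symm.trans e')).1
    | pcase_one_one _ _ _ _ _ _ e' => cases (TypeTree.bin_inj.1 (e.symm.trans e')).1
    | pcase_pair_pair _ _ _ _ _ _ e' => cases (TypeTree.bin_inj.1 (e.symm.trans e')).1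
  | pcase_arr _ _ e' h1 h2 h3 h4 =>
    obtain ⟨-, rfl, rfl⟩ := TypeTree.bin_inj.1 (e.symm.trans e')
    exact .app3 _ (hx _ h1) (.app (hy _ h2) (hw _ h4)) (.app (hz _ h3) (hw _ h4))

end IsDev

/-- Every typed term has a complete development. -/
theorem HasTree.exists_isDev {Γ : List ClosedType} {M : Term} {t : TypeTree}
    (h : HasTree Γ M t) : ∃ M', IsDev M M' := by
  -- Induction on size, since a redex needs developments of subterms several levels down.
  induction hn : sizeOf M using Nat.strong_induction_on generalizing Γ M t with | _ n ih
  subst hn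
  have ih : ∀ K, sizeOf K < sizeOf M → ∀ {Γ t}, HasTree Γ K t → ∃ K', IsDev K K' :=
    fun K hK _ _ hK' => ih _ hK hK' rfl
  cases M with
  | fvar σ n => exact ⟨_, fun N hN => by cases hN; exact .refl _⟩
  | bvar i => exact ⟨_, fun N hN => by cases hN; exact .refl _⟩
  | const c => exact ⟨_, fun N hN => by cases hN; exact .refl _⟩
  | lam σ B =>
    obtain ⟨u, hB, -⟩ := h
    obtain ⟨B', hB'⟩ := ih B (by simp) hB
    exact ⟨_, hB'.lam σ⟩
  | app F w =>
    have ht := h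
    obtain ⟨s, hF, hw⟩ := h
    obtain ⟨w', hw'⟩ := ih w (by simp) hw
    by_cases c1 : ∃ σ B, F = .lam σ B
    · obtain ⟨σ, B, rfl⟩ := c1
      obtain ⟨u, hB, -⟩ := hF
      obtain ⟨B', hB'⟩ := ih B (by simp; omega) hB
      exact ⟨_, hB'.beta σ hw'⟩
    by_cases c2 : ∃ σ τ ρ σ' τ' x y, F = app2 (.scase σ τ ρ) (app1 (.zero σ' τ') x) y
    · obtain ⟨σ, τ, ρ, σ', τ', x, y, rfl⟩ := c2
      obtain ⟨_, ⟨_, _, _, _, hx⟩, hy⟩ := hF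
      obtain ⟨x', hx'⟩ := ih x (by simp; omega) hx
      obtain ⟨y', hy'⟩ := ih y (by simp; omega) hy
      exact ⟨_, hx'.case_zero _ _ _ _ _ _ hy'⟩
    by_cases c3 : ∃ σ τ ρ σ' τ' x y, F = app2 (.scase σ τ ρ) (app1 (.one σ' τ') x) y
    · obtain ⟨σ, τ, ρ, σ', τ', x, y, rfl⟩ := c3
      obtain ⟨_, ⟨_, _, _, _, hx⟩, hy⟩ := hF
      obtain ⟨x', hx'⟩ := ih x (by simp; omega) hx
      exact ⟨_, hx'.case_one _ _ _ _ _ _ hw'⟩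
    by_cases c4 : ∃ σ τ σ' τ' x y, F = .const (.fst σ τ) ∧ w = app2 (.pair σ' τ') x y
    · obtain ⟨σ, τ, σ', τ', x, y, rfl, rfl⟩ := c4
      obtain ⟨x', hx'⟩ := ih x (by simp; omega) hw.pair_inv.2.1
      exact ⟨_, hx'.fst_pair _ _ _ _ _⟩
    by_cases c5 : ∃ σ τ σ' τ' x y, F = .const (.snd σ τ) ∧ w = app2 (.pair σ' τ') x y
    · obtain ⟨σ, τ, σ', τ', x, y, rfl, rfl⟩ := c5
      obtain ⟨y', hy'⟩ := ih y (by simp; omega) hw.pair_inv.2.2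
      exact ⟨_, hy'.snd_pair _ _ _ _ _⟩
    by_cases c6 : ∃ σ τ ρ σ' τ' x y, F = app2 (.pcase σ τ ρ) (app1 (.zero σ' τ') x) y
    · obtain ⟨σ, τ, ρ, σ', τ', x, y, rfl⟩ := c6
      obtain ⟨y', hy'⟩ := ih y (by simp; omega) ht.pcase_inv.2.1
      exact ⟨_, hy'.pcase_zero ht⟩
    by_cases c7 : ∃ σ τ ρ σ' τ' x y, F = app2 (.pcase σ τ ρ) (app1 (.one σ' τ') x) y
    · obtain ⟨σ, τ, ρ, σ', τ', x, y, rfl⟩ := c7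
      exact ⟨_, hw'.pcase_one ht⟩
    have hi : ∀ σ τ ρ x y, F = app2 (.pcase σ τ ρ) x y → ¬ x.IsInjection := by
      rintro σ τ ρ x y rfl ⟨σ', τ', a, rfl | rfl⟩
      · exact c6 ⟨_, _, _, _, _, _, _, rfl⟩
      · exact c7 ⟨_, _, _, _, _, _, _, rfl⟩
    by_cases c8 : ∃ σ τ ρ₀ ρ₁ σ' τ' σ'' τ'' x y z,
        F = app2 (.pcase σ τ (.sum ρ₀ ρ₁)) x (app1 (.zero σ' τ') y) ∧ w = app1 (.zero σ'' τ'') z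
    · obtain ⟨σ, τ, ρ₀, ρ₁, σ', τ', σ'', τ'', x, y, z, rfl, rfl⟩ := c8
      obtain ⟨hx, hy, hz⟩ := ht.pcase_inv
      obtain ⟨x', hx'⟩ := ih x (by simp; omega) hx
      obtain ⟨y', hy'⟩ := ih y (by simp; omega) hy.zero_inv.2
      obtain ⟨z', hz'⟩ := ih z (by simp; omega) hz.zero_inv.2
      exact ⟨_, hx'.pcase_zero_zero _ _ _ _ _ _ rfl (hi _ _ _ _ _ rfl) hy' hz'⟩
    by_cases c9 : ∃ σ τ ρ₀ ρ₁ σ' τ' σ'' τ'' x y z,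
        F = app2 (.pcase σ τ (.sum ρ₀ ρ₁)) x (app1 (.one σ' τ') y) ∧ w = app1 (.one σ'' τ'') z
    · obtain ⟨σ, τ, ρ₀, ρ₁, σ', τ', σ'', τ'', x, y, z, rfl, rfl⟩ := c9
      obtain ⟨hx, hy, hz⟩ := ht.pcase_inv
      obtain ⟨x', hx'⟩ := ih x (by simp; omega) hx
      obtain ⟨y', hy'⟩ := ih y (by simp; omega) hy.one_inv.2
      obtain ⟨z', hz'⟩ := ih z (by simp; omega) hz.one_inv.2
      exact ⟨_, hx'.pcase_one_one _ _ _ _ _ _ rfl (hi _ _ _ _ _ rfl) hy' hz'⟩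
    by_cases c10 : ∃ σ τ ρ₁ ρ₂ σ' τ' σ'' τ'' x y₁ y₂ z₁ z₂,
        F = app2 (.pcase σ τ (.prod ρ₁ ρ₂)) x (app2 (.pair σ' τ') y₁ y₂) ∧
          w = app2 (.pair σ'' τ'') z₁ z₂
    · obtain ⟨σ, τ, ρ₁, ρ₂, σ', τ', σ'', τ'', x, y₁, y₂, z₁, z₂, rfl, rfl⟩ := c10
      obtain ⟨hx, hy, hz⟩ := ht.pcase_inv
      obtain ⟨x', hx'⟩ := ih x (by simp; omega) hx
      obtain ⟨y₁', hy₁'⟩ := ih y₁ (by simp; omega) hy.pair_inv.2.1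
      obtain ⟨y₂', hy₂'⟩ := ih y₂ (by simp; omega) hy.pair_inv.2.2
      obtain ⟨z₁', hz₁'⟩ := ih z₁ (by simp; omega) hz.pair_inv.2.1
      obtain ⟨z₂', hz₂'⟩ := ih z₂ (by simp; omega) hz.pair_inv.2.2
      exact ⟨_, hx'.pcase_pair_pair _ _ _ _ _ _ rfl (hi _ _ _ _ _ rfl) hy₁' hy₂' hz₁' hz₂'⟩
    -- If `x` is an injection, the outer redex is left alone, so that the inner branch selection
    -- takes priority.
    by_cases c11 : ∃ σ τ ρ₁ ρ₂ x y z,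
        F = app3 (.pcase σ τ (.arr ρ₁ ρ₂)) x y z ∧ ¬ x.IsInjection
    · obtain ⟨σ, τ, ρ₁, ρ₂, x, y, z, rfl, hxi⟩ := c11
      obtain ⟨hx, hy, hz⟩ := hF.pcase_inv
      obtain ⟨x', hx'⟩ := ih x (by simp; omega) hx
      obtain ⟨y', hy'⟩ := ih y (by simp; omega) hy
      obtain ⟨z', hz'⟩ := ih z (by simp; omega) hz
      exact ⟨_, hx'.pcase_arr _ _ rfl hxi hy' hz' hw'⟩
    obtain ⟨F', hF'⟩ := ih F (by simp; omega) hF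
    refine ⟨.app F' w', fun K hK => ?_⟩
    cases hK with
    | app h1 h2 => exact .app (hF' _ h1) (hw' _ h2)
    | beta => exact absurd ⟨_, _, rfl⟩ c1
    | case_zero => exact absurd ⟨_, _, _, _, _, _, _, rfl⟩ c2
    | case_one => exact absurd ⟨_, _, _, _, _, _, _, rfl⟩ c3
    | fst_pair => exact absurd ⟨_, _, _, _, _, _, rfl, rfl⟩ c4
    | snd_pair => exact absurd ⟨_, _, _, _, _, _, rfl, rfl⟩ c5
    | pcase_zero => exact absurd ⟨_, _, _, _, _, _, _, rfl⟩ c6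
    | pcase_one => exact absurd ⟨_, _, _, _, _, _, _, rfl⟩ c7
    | pcase_zero_zero _ _ _ _ _ _ e =>
      subst e
      exact absurd ⟨_, _, _, _, _, _, _, _, _, _, _, rfl, rfl⟩ c8
    | pcase_one_one _ _ _ _ _ _ e =>
      subst e
      exact absurd ⟨_, _, _, _, _, _, _, _, _, _, _, rfl, rfl⟩ c9
    | pcase_pair_pair _ _ _ _ _ _ e =>
      subst e
      exact absurd ⟨_, _, _, _, _, _, _, _, _, _, _, _, _, rfl, rfl⟩ c10
    -- Here `w` was pushed into both branches although `x` may be an injection. Selecting the branch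
    -- leaves an application whose head is a reduct of `F`, hence goes to `F'`.
    | @pcase_arr _ _ _ _ _ x _ _ _ _ _ _ _ e h1 h2 h3 h4 =>
      subst e
      by_cases hxi : x.IsInjection
      · obtain ⟨σ', τ', a, rfl | rfl⟩ := hxi
        · obtain ⟨a', rfl, -⟩ := h1.zero_inv
          exact .pcase_zero _ _ _ _ _ _ _
            (.app (hF' _ (.pcase_zero _ _ _ _ _ _ _ h2)) (hw' _ h4))
        · obtain ⟨a', rfl, -⟩ := h1.one_inv
          exact .pcase_one _ _ _ _ _ _ _
            (.app (hF' _ (.pcase_one _ _ _ _ _ _ _ h3)) (hw' _ h4))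
      · exact absurd ⟨_, _, _, _, _, _, _, rfl, hxi⟩ c11

/-! ## Confluence -/

/-- Reduction is confluent on typed terms. -/
theorem HasTree.confluent {Γ : List ClosedType} {M N P : Term} {t : TypeTree}
    (h : HasTree Γ M t) (hN : Reds M N) (hP : Reds M P) : ∃ Q, Reds N Q ∧ Reds P Q := by
  -- Restricting `Par` to terms of tree `t` makes developments available at every source; subject
  -- reduction keeps the chains inside.
  let r : Term → Term → Prop := fun a b => HasTree Γ a t ∧ Par a b
  have lift : ∀ {K}, Reds M K → Relation.ReflTransGen r M K := fun hK => by
    induction hK with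
    | refl => exact .refl
    | tail hs hr ih => exact ih.tail ⟨h.reds hs, .of_red hr⟩
  have lower : ∀ {K L}, Relation.ReflTransGen r K L → Reds K L := fun hK => by
    induction hK with
    | refl => exact .refl _
    | tail _ hr ih => exact Relation.ReflTransGen.trans ih hr.2.reds
  obtain ⟨Q, hQ, hQ'⟩ := Relation.church_rosser (r := r) (fun a b c hb hc => by
    obtain ⟨a', ha'⟩ := hb.1.exists_isDev
    exact ⟨a', .single ⟨hb.1.par hb.2, ha' _ hb.2⟩, .single ⟨hb.1.par hc.2, ha' _ hc.2⟩⟩)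
    (lift hN) (lift hP)
  exact ⟨Q, lower hQ, lower hQ'⟩

end RecTypedCalculus

theorem mainTheorem4 (M N P : RecTypedCalculus.Term)
    (hM : ∃ σ : RecTypedCalculus.ClosedType, M.OfType σ)
    (hN : RecTypedCalculus.Reds M N) (hP : RecTypedCalculus.Reds M P) :
    ∃ Q : RecTypedCalculus.Term,
      RecTypedCalculus.Reds N Q ∧ RecTypedCalculus.Reds P Q ∧
      ∀ σ τ : RecTypedCalculus.ClosedType, M.OfType σ →
        (N.OfType τ ↔ σ ≈ τ) ∧ (P.OfType τ ↔ σ ≈ τ) ∧ (Q.OfType τ ↔ σ ≈ τ) := by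
  obtain ⟨σ₀, h₀⟩ := hM
  obtain ⟨Q, hNQ, hPQ⟩ := (RecTypedCalculus.HasType.hasTree h₀).confluent hN hP
  refine ⟨Q, hNQ, hPQ, fun σ τ h => ?_⟩
  have ht := RecTypedCalculus.HasType.hasTree h
  rw [← RecTypedCalculus.ClosedType.toTree_eq_iff]
  -- All reducts keep the tree of `σ`, and a tree determines exactly which types a term has.
  exact ⟨(ht.reds hN).ofType_iff τ, (ht.reds hP).ofType_iff τ,
    ((ht.reds hN).reds hNQ).ofType_iff τ⟩
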